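/- Let $n_x\ge 0$, $n=n_x+1$, and let $\mathcal N(\mu_k,\Sigma_k)$, $k=1,\dots,K$, be Gaussian distributions on $\mathbb R^n$ (the modes of a Gaussian mixture), with $\mu_k\in\mathbb R^n$ and $\Sigma_k$ positive semidefinite. Let $\beta\in(0,1)$. Let $\varepsilon_k\in(0,1)$ be risk levels, and let $\Psi^{-1}$ and $\Phi$ denote the quantile function and the density of the standard normal distribution. Either (chance constraint) $\varepsilon_k\le\frac12$ and $\Gamma_k=\Psi^{-1}(1-\varepsilon_k)$ for all $k$, or (CVaR constraint) $\Gamma_k=\Phi(\Psi^{-1}(1-\varepsilon_k))/\varepsilon_k$ for all $k$. For each mode $k$ let $\delta_{k,1},\dots,\delta_{k,N_k}$, $N_k\ge 2$, be independent samples from $\mathcal N(\mu_k,\Sigma_k)$, with sample mean and unbiased sample covariance $$\hat\mu_k=\frac1{N_k}\sum_{i=1}^{N_k}\delta_{k,i},\qquad \hat\Sigma_k=\frac1{N_k-1}\sum_{i=1}^{N_k}(\delta_{k,i}-\hat\mu_k)(\delta_{k,i}-\hat\mu_k)^{\top}.$$ Let $T^2_{a,b}(p)$ be the $p$-th quantile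 of Hotelling's $T^2$-distribution with parameters $a$ (dimension) and $b$ (degrees of freedom), and $\chi^2_{m,p}$ the $p$-th quantile of the $\chi^2$-distribution with $m$ degrees of freedom. Fix $x\in\mathbb R^{n_x}$ (not depending on the samples), put $\tilde x=(x^\top,1)^\top$, and define $$r_{1,k}(x)=\sqrt{\frac{T^2_{1,N_k-1}(1-\beta)}{N_k}}\sqrt{\tilde x^\top\hat\Sigma_k\tilde x},\qquad r_{2,k}=\max\Big\{\Big|1-\frac{N_k-1}{\chi^2_{N_k-1,1-\beta/2}}\Big|,\Big|1-\frac{N_k-1}{\chi^2_{N_k-1,\beta/2}}\Big|\Big\}.$$ Then, with probability at least $1-2\beta$ over the samples, the following implication holds: if $$\Gamma_k\sqrt{(1+r_{2,k})\,\tilde x^\top\hat\Sigma_k\tilde x}+r_{1,k}(x)+\hat\mu_k^\top\tilde x\le 0\quad\text{for all }k=1,\dots,K,$$ then $$\Gamma_k\sqrt{\tilde x^\top\Sigma_k\tilde x}+\mu_k^\top\tilde x\le 0\quad\text{for all }k=1,\dots,K.$$ -/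

import Mathlib

open MeasureTheory ProbabilityTheory

noncomputable section

/-- The `p`-th quantile of a distribution on the real line, `inf {t | p ≤ ν((-∞, t])}`. -/
def quantileOf (ν : Measure ℝ) (p : ℝ) : ℝ :=
  sInf {t : ℝ | p ≤ ν.real (Set.Iic t)}

/-- The law of `m` independent standard Gaussian variables. -/
def stdGaussianPi (m : ℕ) : Measure (Fin m → ℝ) :=
  Measure.pi fun _ => gaussianReal 0 1

/-- The `χ²`-distribution with `m` degrees of freedom: the law of the sum of the squares of `m`
independent standard Gaussian variables. -/
def chiSquareLaw (m : ℕ) : Measure ℝ :=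
  (stdGaussianPi m).map fun z => ∑ i, z i ^ 2

/-- The Hotelling `T²`-distribution with parameters `a` (dimension) and `b` (degrees of freedom):
the law of `b * zᵀ W⁻¹ z`, where `z` is standard Gaussian in dimension `a` and `W = Gᵀ G` is an
independent Wishart matrix, `G` having `b` independent standard Gaussian rows. -/
def hotellingLaw (a b : ℕ) : Measure ℝ :=
  ((stdGaussianPi a).prod (Measure.pi fun _ : Fin b => stdGaussianPi a)).map
    fun q => (b : ℝ) * (q.1 ⬝ᵥ Matrix.mulVec
      ((Matrix.of q.2).transpose * Matrix.of q.2)⁻¹ q.1)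

/-- The two kinds of constraint: the chance constraint and its CVaR approximation. -/
inductive RiskKind where
  | chance
  | cvar

/-- The coefficient `Γ` of the second-order cone constraint at risk level `ε`: the standard normal
quantile `Ψ⁻¹(1 - ε)` for the chance constraint, and the standard normal density at that quantile,
divided by `ε`, for the CVaR constraint. -/
def riskCoeff : RiskKind → ℝ → ℝ
  | .chance, ε => quantileOf (gaussianReal 0 1) (1 - ε)
  | .cvar, ε => gaussianPDFReal 0 1 (quantileOf (gaussianReal 0 1) (1 - ε)) / ε

/-- The extended vector `x̃ = (x, 1)`. -/
def extendOne {n : ℕ} (x : EuclideanSpace ℝ (Fin n)) : Fin (n + 1) → ℝ :=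
  Fin.snoc (α := fun _ => ℝ) (fun i => x i) 1

/-- The quadratic form `vᵀ S v`. -/
def quadForm {d : ℕ} (S : Matrix (Fin d) (Fin d) ℝ) (v : Fin d → ℝ) : ℝ :=
  v ⬝ᵥ Matrix.mulVec S v

/-- The linear form `mᵀ v`. -/
def linForm {d : ℕ} (m : EuclideanSpace ℝ (Fin d)) (v : Fin d → ℝ) : ℝ :=
  ∑ i, m i * v i

/-- The sample mean. -/
def sampleMean {d N : ℕ} (y : Fin N → EuclideanSpace ℝ (Fin d)) : EuclideanSpace ℝ (Fin d) :=
  (N : ℝ)⁻¹ • ∑ i, y i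

/-- The (unbiased) sample covariance matrix. -/
def sampleCov {d N : ℕ} (y : Fin N → EuclideanSpace ℝ (Fin d)) : Matrix (Fin d) (Fin d) ℝ :=
  Matrix.of fun a b =>
    ((N : ℝ) - 1)⁻¹ * ∑ i, (y i a - sampleMean y a) * (y i b - sampleMean y b)

/-- The mean margin
`r₁ = √(T²_{1, N - 1}(1 - β) / N) * √(vᵀ Σ̂ v)`, where `Ŝ` is the estimated covariance. -/
def meanMargin {d : ℕ} (N : ℕ) (β : ℝ) (Ŝ : Matrix (Fin d) (Fin d) ℝ) (v : Fin d → ℝ) : ℝ :=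
  Real.sqrt (quantileOf (hotellingLaw 1 (N - 1)) (1 - β) / N) * Real.sqrt (quadForm Ŝ v)

/-- The covariance inflation
`r₂ = max {|1 - (N - 1) / χ²_{N - 1, 1 - β/2}|, |1 - (N - 1) / χ²_{N - 1, β/2}|}`. -/
def covInflation (N : ℕ) (β : ℝ) : ℝ :=
  max |1 - ((N : ℝ) - 1) / quantileOf (chiSquareLaw (N - 1)) (1 - β / 2)|
    |1 - ((N : ℝ) - 1) / quantileOf (chiSquareLaw (N - 1)) (β / 2)|

/-- The exact deterministic constraint of one mode, `Γ √(vᵀ S v) + mᵀ v ≤ 0`. -/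
def ExactConstraint {d : ℕ} (Γ : ℝ) (m : EuclideanSpace ℝ (Fin d))
    (S : Matrix (Fin d) (Fin d) ℝ) (v : Fin d → ℝ) : Prop :=
  Γ * Real.sqrt (quadForm S v) + linForm m v ≤ 0

/-- The robustified constraint of one mode, computed from the samples `y` of that mode:
`Γ √((1 + r₂) vᵀ Σ̂ v) + r₁ + μ̂ᵀ v ≤ 0`. -/
def RobustConstraint {d N : ℕ} (Γ β : ℝ) (y : Fin N → EuclideanSpace ℝ (Fin d))
    (v : Fin d → ℝ) : Prop :=
  Γ * Real.sqrt ((1 + covInflation N β) * quadForm (sampleCov y) v)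
    + meanMargin N β (sampleCov y) v + linForm (sampleMean y) v ≤ 0

end

/-!
The exact constraints do not depend on the samples. If they all hold there is nothing to prove;
otherwise one mode `k` violates its exact constraint, and it suffices that this single mode passes
its robust test with probability at most `2 * β`. No union bound over the modes and no independence
between modes is involved.

For one mode, put `v = x̃` and project the samples to `Y i = linForm (δ i) v`. These are i.i.d. real
Gaussian variables with mean `m = linForm μ v` and variance `s ^ 2 = quadForm S v`, and the robust
constraint involves only their mean and their sum of squared deviations. If `s = 0` all samples
equal `m` almost surely and the robust constraint is the exact one. If `s > 0`, the standardized
sample is a standard Gaussian vector, and a rotation taking `(1, …, 1) / √N` to the first basis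
vector shows that `√N` times its mean and its sum of squared deviations are distributed as `z` and
`∑ g i ^ 2` for independent standard Gaussian `z, g 0, …, g (N - 2)`
(`hasLaw_sqrt_mul_arithMean_sumSqDev`). Hence the squared deviation sum has the `χ²`-law and the
studentized mean the one-dimensional Hotelling law. Two quantile events follow:
* `m ≤ Ȳ + r₁` outside an event of probability at most `β` (`mean_le_add_margin`);
* `s ^ 2 ≤ (1 + r₂) * v ⬝ᵥ Σ̂ v` outside an event of probability at most `β / 2`
  (`variance_le_inflated`); only the lower `χ²`-quantile in `r₂` is needed.

Since `Γ ≥ 0` for both kinds of constraint, the robust constraint implies the exact one when both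
bounds hold.
-/

/-! ### Quantiles -/

open Filter Topology in
/-- The distribution function reaches the level `p` at the quantile, by right continuity. -/
lemma le_measureReal_Iic_quantileOf (ν : Measure ℝ) [IsProbabilityMeasure ν] {p : ℝ}
    (h1 : p < 1) : p ≤ ν.real (Set.Iic (quantileOf ν p)) := by
  have htop : ∃ t, p < cdf ν t := ((tendsto_cdf_atTop ν).eventually_const_lt h1).exists
  have hcont := (cdf ν).right_continuous (quantileOf ν p)
  rw [← cdf_eq_real]
  refine ge_of_tendsto (hcont.mono_left (nhdsWithin_mono _ Set.Ioi_subset_Ici_self)) ?_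
  filter_upwards [self_mem_nhdsWithin] with t ht
  obtain ⟨s, hs, hst⟩ := exists_lt_of_csInf_lt
    (show {t : ℝ | p ≤ ν.real (Set.Iic t)}.Nonempty by
      obtain ⟨t, ht⟩ := htop
      exact ⟨t, by simpa [cdf_eq_real] using ht.le⟩) (Set.mem_Ioi.1 ht)
  have hs' : p ≤ cdf ν s := by simpa [cdf_eq_real] using hs
  exact hs'.trans (monotone_cdf ν hst.le)

open Filter Topology in
/-- This holds for laws with atoms too: each `Iic t` with `t` below the quantile has mass less
than `p`. -/
lemma measureReal_Iio_quantileOf_le (ν : Measure ℝ) [IsProbabilityMeasure ν] {p : ℝ}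
    (h0 : 0 < p) : ν.real (Set.Iio (quantileOf ν p)) ≤ p := by
  obtain ⟨b, hb⟩ := ((tendsto_cdf_atBot ν).eventually_lt_const h0).exists
  have hbdd : BddBelow {t : ℝ | p ≤ ν.real (Set.Iic t)} := by
    refine ⟨b, fun t ht => ?_⟩
    by_contra! hlt
    have := monotone_cdf ν hlt.le
    simp only [Set.mem_ofPred_eq, ← cdf_eq_real] at ht
    linarith
  obtain ⟨u, hu, hlt, hlim⟩ := exists_seq_strictMono_tendsto (quantileOf ν p)
  have hU : Set.Iio (quantileOf ν p) = ⋃ n, Set.Iic (u n) := by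
    ext t
    simp only [Set.mem_Iio, Set.mem_iUnion, Set.mem_Iic]
    constructor
    · intro ht
      exact ((hlim.eventually_const_lt ht).exists).imp fun _ h => h.le
    · rintro ⟨n, hn⟩
      exact hn.trans_lt (hlt n)
  have hm := tendsto_measure_iUnion_atTop (μ := ν) (s := fun n => Set.Iic (u n))
    (fun i j hij => Set.Iic_subset_Iic.2 (hu.monotone hij))
  rw [← hU] at hm
  have hm' := (ENNReal.tendsto_toReal (measure_ne_top ν _)).comp hm
  refine le_of_tendsto hm' (Eventually.of_forall fun n => ?_)
  have := notMem_of_lt_csInf (hlt n) hbdd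
  exact (not_le.1 this).le

lemma quantileOf_pos (ν : Measure ℝ) [IsProbabilityMeasure ν] {p : ℝ}
    (h0 : 0 < p) (h1 : p < 1) (hν : ν (Set.Iic 0) = 0) : 0 < quantileOf ν p := by
  by_contra! hle
  have h := le_measureReal_Iic_quantileOf ν h1
  rw [measureReal_def, measure_mono_null (Set.Iic_subset_Iic.2 hle) hν] at h
  simp at h
  linarith

lemma quantileOf_gaussianReal_nonneg {p : ℝ} (hp : 1 / 2 ≤ p) :
    0 ≤ quantileOf (gaussianReal 0 1) p := by
  -- If `p ≤ γ (Iic t)` with `t < 0`, then `Iic t`, `Ici (-t)` and `Ioo t (-t)` have total mass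
  -- greater than one.
  refine Real.sInf_nonneg fun t ht => ?_
  by_contra! hneg
  simp only [Set.mem_ofPred_eq] at ht
  set γ := gaussianReal 0 1
  have hsymm : γ.real (Set.Ici (-t)) = γ.real (Set.Iic t) := by
    have hmap : γ.map (fun x => -x) = γ := by simp [γ, gaussianReal_map_neg]
    conv_lhs => rw [← hmap, map_measureReal_apply measurable_neg measurableSet_Ici]
    congr 1
    ext s
    simp
  have hmid : 0 < γ.real (Set.Ioo t (-t)) := by
    refine ENNReal.toReal_pos (fun h => ?_) (measure_ne_top _ _)
    have := gaussianReal_absolutelyContinuous' 0 (v := 1) one_ne_zero h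
    rw [Real.volume_Ioo, ENNReal.ofReal_eq_zero] at this
    linarith
  have hle : γ.real (Set.Iic t ∪ Set.Ioo t (-t) ∪ Set.Ici (-t)) ≤ 1 := measureReal_le_one
  rw [measureReal_union _ measurableSet_Ici, measureReal_union _ measurableSet_Ioo] at hle
  · linarith
  · exact Set.disjoint_left.2 fun s hs hs' => not_lt.2 hs hs'.1
  · refine Set.disjoint_left.2 fun s hs hs' => ?_
    simp only [Set.mem_union, Set.mem_Iic, Set.mem_Ioo, Set.mem_Ici] at hs hs'
    rcases hs with hs | hs <;> linarith

lemma riskCoeff_nonneg {kind : RiskKind} {ε : ℝ} (hε : 0 < ε)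
    (h : kind = RiskKind.chance → ε ≤ 1 / 2) : 0 ≤ riskCoeff kind ε := by
  cases kind with
  | chance => exact quantileOf_gaussianReal_nonneg (by linarith [h rfl])
  | cvar => exact div_nonneg (gaussianPDFReal_nonneg _ _ _) hε.le

/-! ### Mean and squared deviations of a standard Gaussian sample -/

/-- The arithmetic mean of the entries of `y`. -/
noncomputable def arithMean {N : ℕ} (y : Fin N → ℝ) : ℝ := (N : ℝ)⁻¹ * ∑ i, y i

/-- The sum of squared deviations of the entries of `y` from their mean. -/
noncomputable def sumSqDev {N : ℕ} (y : Fin N → ℝ) : ℝ := ∑ i, (y i - arithMean y) ^ 2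

lemma sumSqDev_eq {M : ℕ} (y : Fin (M + 1) → ℝ) :
    sumSqDev y = ∑ i, y i ^ 2 - (M + 1) * arithMean y ^ 2 := by
  have h : ∑ i, y i = (M + 1) * arithMean y := by
    unfold arithMean; push_cast; field_simp
  simp only [sumSqDev, sub_sq, Finset.sum_add_distrib, Finset.sum_sub_distrib, mul_assoc,
    ← Finset.mul_sum, ← Finset.sum_mul, h]
  simp
  ring

lemma arithMean_affine {M : ℕ} (y : Fin (M + 1) → ℝ) (m s : ℝ) :
    arithMean (fun i => (y i - m) / s) = (arithMean y - m) / s := by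
  simp only [arithMean, ← Finset.sum_div, Finset.sum_sub_distrib]
  simp
  field_simp

lemma sumSqDev_affine {M : ℕ} (y : Fin (M + 1) → ℝ) (m s : ℝ) :
    sumSqDev (fun i => (y i - m) / s) = sumSqDev y / s ^ 2 := by
  simp only [sumSqDev, arithMean_affine, Finset.sum_div]
  refine Finset.sum_congr rfl fun i _ => ?_
  rw [← sub_div, div_pow]
  ring

instance (m : ℕ) : IsProbabilityMeasure (stdGaussianPi m) := by
  unfold stdGaussianPi; infer_instance

instance (m : ℕ) : IsProbabilityMeasure (chiSquareLaw m) :=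
  Measure.isProbabilityMeasure_map
    (show Measurable fun z : Fin m → ℝ => ∑ i, z i ^ 2 by fun_prop).aemeasurable

/-- The standard Gaussian law is invariant under passing to coordinates in an orthonormal basis. -/
lemma measurePreserving_repr_stdGaussianPi {m : ℕ}
    (b : OrthonormalBasis (Fin m) ℝ (EuclideanSpace ℝ (Fin m))) :
    MeasurePreserving (fun z : Fin m → ℝ => (b.repr (WithLp.toLp 2 z)).ofLp)
      (stdGaussianPi m) (stdGaussianPi m) := by
  refine ⟨by fun_prop, ?_⟩
  have h := stdGaussian_map (E := EuclideanSpace ℝ (Fin m)) b.repr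
  rw [← map_pi_eq_stdGaussian, Measure.map_map (by fun_prop) (by fun_prop)] at h
  have h' := congrArg (Measure.map (WithLp.ofLp (p := 2) (V := Fin m → ℝ))) h
  rw [Measure.map_map (by fun_prop) (by fun_prop), Measure.map_map (by fun_prop) (by fun_prop)] at h'
  have hid : (WithLp.ofLp (p := 2) (V := Fin m → ℝ)) ∘ (WithLp.toLp 2) = id := rfl
  rw [hid, Measure.map_id] at h'
  exact h'

/-- A Helmert-type rotation: its first coordinate is the normalized mean, so by Pythagoras the
remaining coordinates carry the sum of squared deviations. -/
lemma exists_measurePreserving_arithMean_sumSqDev (M : ℕ) :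
    ∃ U : (Fin (M + 1) → ℝ) → (Fin (M + 1) → ℝ),
      MeasurePreserving U (stdGaussianPi (M + 1)) (stdGaussianPi (M + 1)) ∧
      (∀ z, U z 0 = √(M + 1) * arithMean z) ∧
      ∀ z, ∑ i : Fin M, U z i.succ ^ 2 = sumSqDev z := by
  have hM : (0 : ℝ) < M + 1 := by positivity
  let e : EuclideanSpace ℝ (Fin (M + 1)) := WithLp.toLp 2 fun _ => (√(M + 1))⁻¹
  have he : ‖e‖ = 1 := by
    rw [EuclideanSpace.norm_eq]
    simp [e, Real.sq_sqrt hM.le]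
    field_simp
  obtain ⟨b, hb⟩ := Orthonormal.exists_orthonormalBasis_extension_of_card_eq
    (𝕜 := ℝ) (E := EuclideanSpace ℝ (Fin (M + 1))) (ι := Fin (M + 1)) (by simp)
    (v := fun _ => e) (s := {0}) (by
      constructor
      · intro i; simpa using he
      · intro i j hij; exact absurd (Subsingleton.elim i j) hij)
  have hb0 : b 0 = e := hb 0 rfl
  -- The coordinate along the normalized all-ones vector is the normalized mean.
  have h0 (z : Fin (M + 1) → ℝ) : (b.repr (WithLp.toLp 2 z)).ofLp 0 = √(M + 1) * arithMean z := by
    rw [b.repr_apply_apply, hb0, PiLp.inner_apply]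
    simp [e, arithMean, ← Finset.sum_mul]
    have := Real.sq_sqrt hM.le
    field_simp
    rw [this]
  refine ⟨_, measurePreserving_repr_stdGaussianPi b, h0, fun z => ?_⟩
  have hn : ‖b.repr (WithLp.toLp 2 z)‖ ^ 2 = ‖WithLp.toLp 2 z‖ ^ 2 := by
    rw [LinearIsometryEquiv.norm_map]
  rw [EuclideanSpace.norm_sq_eq, EuclideanSpace.norm_sq_eq, Fin.sum_univ_succ, h0] at hn
  simp only [Real.norm_eq_abs, sq_abs, mul_pow, Real.sq_sqrt hM.le] at hn
  rw [sumSqDev_eq]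
  linarith

/-- The joint law of the normalized mean and the sum of squared deviations of a standard Gaussian
sample of size `M + 1`; in particular the two are independent. -/
lemma hasLaw_sqrt_mul_arithMean_sumSqDev (M : ℕ) :
    HasLaw (fun z => (√(M + 1) * arithMean z, sumSqDev z))
      (((gaussianReal 0 1).prod (stdGaussianPi M)).map fun q => (q.1, ∑ i, q.2 i ^ 2))
      (stdGaussianPi (M + 1)) := by
  obtain ⟨U, hU, h0, h1⟩ := exists_measurePreserving_arithMean_sumSqDev M
  have hsplit := measurePreserving_piFinSuccAbove (fun _ : Fin (M + 1) => gaussianReal 0 1) 0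
  have hfin : MeasurePreserving (fun q : ℝ × (Fin M → ℝ) => (q.1, ∑ i, q.2 i ^ 2))
      ((gaussianReal 0 1).prod (stdGaussianPi M)) _ := Measurable.measurePreserving (by fun_prop) _
  refine ((hfin.comp hsplit).comp hU).hasLaw.congr (ae_of_all _ fun z => ?_)
  simp [MeasurableEquiv.piFinSuccAbove, Fin.insertNthEquiv, Fin.tail, h0, h1]

lemma hasLaw_sumSqDev_chiSquareLaw (M : ℕ) :
    HasLaw sumSqDev (chiSquareLaw M) (stdGaussianPi (M + 1)) := by
  have h := hasLaw_sqrt_mul_arithMean_sumSqDev M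
  have hsnd : MeasurePreserving Prod.snd
      (((gaussianReal 0 1).prod (stdGaussianPi M)).map fun q => (q.1, ∑ i, q.2 i ^ 2))
      (chiSquareLaw M) := by
    refine ⟨measurable_snd, ?_⟩
    rw [Measure.map_map (by fun_prop) (by fun_prop), chiSquareLaw]
    conv_rhs =>
      rw [← (measurePreserving_snd (μ := gaussianReal 0 1) (ν := stdGaussianPi M)).map_eq,
        Measure.map_map (by fun_prop) (by fun_prop)]
    rfl
  exact hsnd.comp_hasLaw h

/-- In dimension one the Wishart matrix is the scalar `∑ i, g i ^ 2`. -/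
lemma hotellingLaw_one (M : ℕ) :
    hotellingLaw 1 M = ((gaussianReal 0 1).prod (stdGaussianPi M)).map
      fun q => (M : ℝ) * (q.1 ^ 2 * (∑ i, q.2 i ^ 2)⁻¹) := by
  have h1 : MeasurePreserving (fun (a : ℝ) (_ : Fin 1) => a) (gaussianReal 0 1)
      (stdGaussianPi 1) :=
    (measurePreserving_funUnique (gaussianReal 0 1) (Fin 1)).symm _
  have h2 : MeasurePreserving (fun (g : Fin M → ℝ) i (_ : Fin 1) => g i) (stdGaussianPi M)
      (Measure.pi fun _ => stdGaussianPi 1) :=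
    measurePreserving_pi _ _ fun _ => h1
  rw [hotellingLaw, ← (h1.prod h2).map_eq, Measure.map_map _ (by fun_prop)]
  · congr 1
    ext q
    simp [Matrix.mulVec, dotProduct, Matrix.mul_apply]
    left
    ring_nf
  · simp [Matrix.mulVec, dotProduct, Matrix.mul_apply]
    fun_prop

instance (M : ℕ) : IsProbabilityMeasure (hotellingLaw 1 M) := by
  rw [hotellingLaw_one]
  exact Measure.isProbabilityMeasure_map (by fun_prop)

lemma hasLaw_hotellingLaw (M : ℕ) :
    HasLaw (fun z => (M : ℝ) * ((√(M + 1) * arithMean z) ^ 2 * (sumSqDev z)⁻¹))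
      (hotellingLaw 1 M) (stdGaussianPi (M + 1)) := by
  have h := hasLaw_sqrt_mul_arithMean_sumSqDev M
  have hf : MeasurePreserving (fun r : ℝ × ℝ => (M : ℝ) * (r.1 ^ 2 * r.2⁻¹))
      (((gaussianReal 0 1).prod (stdGaussianPi M)).map fun q => (q.1, ∑ i, q.2 i ^ 2))
      (hotellingLaw 1 M) := by
    refine ⟨by fun_prop, ?_⟩
    rw [Measure.map_map (by fun_prop) (by fun_prop), hotellingLaw_one]
    rfl
  exact hf.comp_hasLaw h

/-- For `m ≠ 0` the `χ²`-law charges only the positive half-line, so that its quantiles are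
positive. -/
lemma chiSquareLaw_Iic_zero {m : ℕ} (hm : m ≠ 0) : chiSquareLaw m (Set.Iic 0) = 0 := by
  obtain ⟨m, rfl⟩ := Nat.exists_eq_succ_of_ne_zero hm
  rw [chiSquareLaw, Measure.map_apply (by fun_prop) measurableSet_Iic]
  have h0 : stdGaussianPi (m + 1) ((fun z => z 0) ⁻¹' {0}) = 0 := by
    have he : MeasurePreserving (fun z : Fin (m + 1) → ℝ => z 0) (stdGaussianPi (m + 1))
        (gaussianReal 0 1) := measurePreserving_eval (fun _ => gaussianReal 0 1) 0
    have := nullSingletonClass_gaussianReal (μ := 0) (v := 1) one_ne_zero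
    rw [he.measure_preimage (measurableSet_singleton _).nullMeasurableSet, measure_singleton]
  refine measure_mono_null (fun z hz => ?_) h0
  have hz' : ∑ i, z i ^ 2 ≤ 0 := hz
  have := Finset.single_le_sum (f := fun i => z i ^ 2) (fun i _ => sq_nonneg _) (Finset.mem_univ 0)
  simp only [Set.mem_preimage, Set.mem_singleton_iff]
  exact pow_eq_zero_iff two_ne_zero |>.1 (le_antisymm (this.trans hz') (sq_nonneg _))

/-! ### Projection of the samples to the line -/

lemma linForm_sampleMean {d N : ℕ} (y : Fin N → EuclideanSpace ℝ (Fin d)) (v : Fin d → ℝ) :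
    linForm (sampleMean y) v = arithMean fun i => linForm (y i) v := by
  simp only [linForm, sampleMean, arithMean, PiLp.smul_apply, smul_eq_mul, mul_assoc,
    ← Finset.mul_sum, WithLp.ofLp_sum, Finset.sum_apply, Finset.sum_mul]
  rw [Finset.sum_comm]

lemma quadForm_sampleCov {d N : ℕ} (y : Fin N → EuclideanSpace ℝ (Fin d)) (v : Fin d → ℝ) :
    quadForm (sampleCov y) v = ((N : ℝ) - 1)⁻¹ * sumSqDev fun i => linForm (y i) v := by
  have h (i : Fin N) : linForm (y i) v - arithMean (fun i => linForm (y i) v) =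
      ∑ a, (y i a - sampleMean y a) * v a := by
    rw [← linForm_sampleMean, linForm, linForm, ← Finset.sum_sub_distrib]
    simp only [sub_mul]
  simp only [sumSqDev, h, sq, Finset.sum_mul_sum]
  rw [Finset.sum_comm, Finset.mul_sum, quadForm, dotProduct]
  refine Finset.sum_congr rfl fun a _ => ?_
  rw [Finset.sum_comm, Finset.mul_sum, Matrix.mulVec, dotProduct, Finset.mul_sum]
  refine Finset.sum_congr rfl fun b _ => ?_
  simp only [sampleCov, Matrix.of_apply, Finset.mul_sum, Finset.sum_mul]
  refine Finset.sum_congr rfl fun i _ => ?_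
  ring

lemma hasLaw_linForm_multivariateGaussian {d : ℕ} {μ : EuclideanSpace ℝ (Fin d)}
    {S : Matrix (Fin d) (Fin d) ℝ} (hS : S.PosSemidef) (v : Fin d → ℝ) :
    HasLaw (fun y => linForm y v) (gaussianReal (linForm μ v) (quadForm S v).toNNReal)
      (multivariateGaussian μ S) := by
  let L : StrongDual ℝ (EuclideanSpace ℝ (Fin d)) := innerSL ℝ (WithLp.toLp 2 v)
  have hL : (fun y : EuclideanSpace ℝ (Fin d) => linForm y v) = L := by
    ext y
    simp [L, linForm, PiLp.inner_apply]
  have hmean : ∫ y, L y ∂(multivariateGaussian μ S) = linForm μ v := by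
    rw [L.integral_comp_comm IsGaussian.integrable_fun_id, integral_id_multivariateGaussian]
    exact (congrFun hL μ).symm
  have hvar : Var[L; multivariateGaussian μ S] = quadForm S v := by
    rw [← covariance_self (by fun_prop)]
    have := covarianceBilin_multivariateGaussian (μ := μ) hS (WithLp.toLp 2 v) (WithLp.toLp 2 v)
    rw [covarianceBilin_apply_eq_cov IsGaussian.memLp_two_id] at this
    exact this
  rw [hL]
  refine ⟨by fun_prop, ?_⟩
  rw [IsGaussian.map_eq_gaussianReal, hmean, hvar]

lemma hasLaw_standardize {Ω : Type*} [MeasurableSpace Ω] {P : Measure Ω}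
    {Y : Ω → ℝ} {m s : ℝ} (hs : 0 < s) (hY : HasLaw Y (gaussianReal m (s ^ 2).toNNReal) P) :
    HasLaw (fun ω => (Y ω - m) / s) (gaussianReal 0 1) P := by
  have h := gaussianReal_div_const (gaussianReal_sub_const hY m) s
  have hv : (s ^ 2).toNNReal / NNReal.mk (s ^ 2) (sq_nonneg s) = 1 := by
    rw [Real.toNNReal_of_nonneg (sq_nonneg s)]
    exact div_self (by simpa [← NNReal.coe_ne_zero] using hs.ne')
  simpa [hv] using h

/-! ### Failure probability of one mode -/

/-- If the `χ²`-statistic `χ = M * V / s ^ 2` is at least the quantile `q`, then the inflated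
estimate of the variance dominates `s ^ 2`. -/
lemma variance_le_inflated {M : ℕ} (hM : M ≠ 0) {s V q χ : ℝ} (r : ℝ)
    (hr : |1 - (M : ℝ) / q| ≤ r) (hq : 0 < q) (hχ : q ≤ χ) (hV : V = (M : ℝ)⁻¹ * (χ * s ^ 2)) :
    s ^ 2 ≤ (1 + r) * V := by
  have hM' : (0 : ℝ) < M := by positivity
  have hr' : (M : ℝ) / q ≤ 1 + r := by linarith [neg_le_abs (1 - (M : ℝ) / q)]
  have hV0 : 0 ≤ V := by rw [hV]; have := hq.trans_le hχ; positivity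
  calc s ^ 2 = (M / q) * ((M : ℝ)⁻¹ * (q * s ^ 2)) := by field_simp
    _ ≤ (M / q) * V := by rw [hV]; gcongr
    _ ≤ _ := by gcongr

/-- If the squared studentized mean is at most `q`, then the true mean `m` exceeds the sample mean
`a` by at most the margin. The statistic is written for the standardized sample, and `W > 0` is
required because it has the junk value `0` at `W = 0`. -/
lemma mean_le_add_margin {M : ℕ} (hM : M ≠ 0) {a m s W q : ℝ} (hs : 0 < s) (hW : 0 < W)
    (h : (M : ℝ) * ((√(M + 1) * ((a - m) / s)) ^ 2 * (W / s ^ 2)⁻¹) ≤ q) :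
    m ≤ √(q / (M + 1)) * √((M : ℝ)⁻¹ * W) + a := by
  have hM' : (0 : ℝ) < M := by positivity
  have hsq : (a - m) ^ 2 ≤ q / (M + 1) * ((M : ℝ)⁻¹ * W) := by
    rw [mul_pow, Real.sq_sqrt (by positivity)] at h
    calc (a - m) ^ 2
        = (M : ℝ) * ((M + 1) * ((a - m) / s) ^ 2 * (W / s ^ 2)⁻¹) / (M + 1) *
            ((M : ℝ)⁻¹ * W) := by field_simp
      _ ≤ _ := by gcongr
  rw [← Real.sqrt_mul' _ (by positivity)]
  have := Real.abs_le_sqrt hsq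
  linarith [neg_le_abs (a - m)]

/-- A mode that violates its exact constraint passes the robust test with probability at most
`2 * β`. -/
lemma measureReal_robustConstraint_le {Ω : Type*} [MeasurableSpace Ω] {P : Measure Ω}
    [IsProbabilityMeasure P] {d N : ℕ} (hN : 2 ≤ N) {μ : EuclideanSpace ℝ (Fin d)}
    {S : Matrix (Fin d) (Fin d) ℝ} (hS : S.PosSemidef)
    {δ : Fin N → Ω → EuclideanSpace ℝ (Fin d)}
    (hlaw : ∀ i, HasLaw (δ i) (multivariateGaussian μ S) P) (hindep : iIndepFun δ P)
    {β : ℝ} (hβ : β ∈ Set.Ioo (0 : ℝ) 1) {Γ : ℝ} (hΓ : 0 ≤ Γ) {v : Fin d → ℝ}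
    (hex : ¬ ExactConstraint Γ μ S v) :
    P.real {ω | RobustConstraint Γ β (fun i => δ i ω) v} ≤ 2 * β := by
  obtain ⟨hβ0, hβ1⟩ := hβ
  obtain ⟨M, rfl⟩ : ∃ M, N = M + 1 := ⟨N - 1, by omega⟩
  have hM : M ≠ 0 := by omega
  set m := linForm μ v with hm
  set s := √(quadForm S v) with hs
  have hquad : 0 ≤ quadForm S v := by
    simpa [quadForm] using hS.dotProduct_mulVec_nonneg v
  have hsq : s ^ 2 = quadForm S v := Real.sq_sqrt hquad
  let Y : Ω → Fin (M + 1) → ℝ := fun ω i => linForm (δ i ω) v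
  have hY (i) : HasLaw (fun ω => Y ω i) (gaussianReal m (s ^ 2).toNNReal) P := by
    rw [hsq]
    exact (hasLaw_linForm_multivariateGaussian hS v).comp (hlaw i)
  have hrob (ω) (h : RobustConstraint Γ β (fun i => δ i ω) v) :
      Γ * √((1 + covInflation (M + 1) β) * ((M : ℝ)⁻¹ * sumSqDev (Y ω)))
        + √(quantileOf (hotellingLaw 1 M) (1 - β) / (M + 1)) * √((M : ℝ)⁻¹ * sumSqDev (Y ω))
        + arithMean (Y ω) ≤ 0 := by
    have h' := h
    simp only [RobustConstraint, meanMargin, quadForm_sampleCov, linForm_sampleMean] at h'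
    simpa using h'
  have hex' : ¬ Γ * s + m ≤ 0 := hex
  have hs_nonneg : 0 ≤ s := Real.sqrt_nonneg _
  rcases hs_nonneg.eq_or_lt with hs0 | hs0
  -- Degenerate projection: the samples are almost surely equal to `m`.
  · have hae : ∀ᵐ ω ∂P, ∀ i, Y ω i = m := by
      rw [ae_all_iff]
      intro i
      have := hY i
      rw [← hs0] at this
      simp only [ne_eq, OfNat.ofNat_ne_zero, not_false_eq_true, zero_pow, Real.toNNReal_zero,
        gaussianReal_zero_var] at this
      exact this.ae_eq_of_dirac
    have hnull : P {ω | RobustConstraint Γ β (fun i => δ i ω) v} = 0 := by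
      rw [measure_eq_zero_iff_ae_notMem]
      filter_upwards [hae] with ω hω hmem
      have h := hrob ω hmem
      have hYc : Y ω = fun _ => m := funext hω
      have hmean : arithMean (Y ω) = m := by
        rw [hYc]
        simp only [arithMean, Finset.sum_const, Finset.card_univ, Fintype.card_fin, nsmul_eq_mul]
        field_simp
      have hdev : sumSqDev (Y ω) = 0 := by simp [sumSqDev, hmean, hω]
      rw [hmean, hdev] at h
      refine hex' ?_
      rw [← hs0]
      simpa using h
    rw [measureReal_def, hnull]
    simp
    exact hβ0.le
  · let Z : Ω → Fin (M + 1) → ℝ := fun ω i => (Y ω i - m) / s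
    have hZ : HasLaw Z (stdGaussianPi (M + 1)) P := by
      refine iIndepFun.hasLaw_pi (fun i => hasLaw_standardize hs0 (hY i)) ?_
      refine hindep.comp (fun _ y => (linForm y v - m) / s) fun _ => ?_
      unfold linForm
      fun_prop
    set qT := quantileOf (hotellingLaw 1 M) (1 - β) with hqT
    set qχ := quantileOf (chiSquareLaw M) (β / 2) with hqχ
    have hqχ0 : 0 < qχ :=
      quantileOf_pos _ (by linarith) (by linarith) (chiSquareLaw_Iic_zero hM)
    have hT := (hasLaw_hotellingLaw M).comp hZ
    have hX := (hasLaw_sumSqDev_chiSquareLaw M).comp hZ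
    have hsub : {ω | RobustConstraint Γ β (fun i => δ i ω) v} ⊆
        {ω | ((fun z : Fin (M + 1) → ℝ =>
          (M : ℝ) * ((√(M + 1) * arithMean z) ^ 2 * (sumSqDev z)⁻¹)) ∘ Z) ω ∈ Set.Ioi qT} ∪
        {ω | (sumSqDev ∘ Z) ω ∈ Set.Iio qχ} := by
      intro ω hω
      by_contra hbad
      simp only [Set.mem_union, Set.mem_ofPred_eq, Set.mem_Ioi, Set.mem_Iio, not_or, not_lt,
        Function.comp_apply] at hbad
      obtain ⟨h1, h2⟩ := hbad
      have hW : sumSqDev (Z ω) = sumSqDev (Y ω) / s ^ 2 := sumSqDev_affine _ _ _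
      have hA : arithMean (Z ω) = (arithMean (Y ω) - m) / s := arithMean_affine _ _ _
      -- Positivity of the `χ²`-quantile excludes a vanishing sample variance.
      have hW0 : 0 < sumSqDev (Y ω) := by
        have h := hqχ0.trans_le h2
        rw [hW] at h
        exact (div_pos_iff_of_pos_right (by positivity)).1 h
      have hmean : m ≤ √(qT / (M + 1)) * √((M : ℝ)⁻¹ * sumSqDev (Y ω)) + arithMean (Y ω) :=
        mean_le_add_margin hM hs0 hW0 (by rw [← hA, ← hW]; exact h1)
      have hvar : s ^ 2 ≤ (1 + covInflation (M + 1) β) * ((M : ℝ)⁻¹ * sumSqDev (Y ω)) := by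
        refine variance_le_inflated hM _ ?_ hqχ0 h2 ?_
        · simp [covInflation, hqχ]
        · rw [hW]; field_simp
      have := mul_le_mul_of_nonneg_left (Real.le_sqrt_of_sq_le hvar) hΓ
      refine hex' ?_
      linarith [hrob ω hω]
    have hpT : (hotellingLaw 1 M).real (Set.Ioi qT) ≤ β := by
      rw [← Set.compl_Iic, measureReal_compl measurableSet_Iic]
      have := le_measureReal_Iic_quantileOf (hotellingLaw 1 M) (p := 1 - β)
        (by linarith)
      simp
      linarith
    have hpχ : (chiSquareLaw M).real (Set.Iio qχ) ≤ β / 2 :=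
      measureReal_Iio_quantileOf_le _ (by linarith)
    refine (measureReal_mono hsub).trans ((measureReal_union_le _ _).trans ?_)
    rw [hT.measureReal_eq (p := (· ∈ Set.Ioi qT)) measurableSet_Ioi,
      hX.measureReal_eq (p := (· ∈ Set.Iio qχ)) measurableSet_Iio]
    simp only [Set.ofPred_mem_eq]
    linarith

theorem theorem1 {Ω : Type*} [MeasurableSpace Ω] (P : Measure Ω) [IsProbabilityMeasure P]
    {n K : ℕ}
    -- true moments of the modes
    (μ : Fin K → EuclideanSpace ℝ (Fin (n + 1)))
    (S : Fin K → Matrix (Fin (n + 1)) (Fin (n + 1)) ℝ)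
    (hS : ∀ k, (S k).PosSemidef)
    -- for every mode, independent samples of that mode
    (N : Fin K → ℕ) (hN : ∀ k, 2 ≤ N k)
    (δ : (k : Fin K) → Fin (N k) → Ω → EuclideanSpace ℝ (Fin (n + 1)))
    (hlaw : ∀ k i, HasLaw (δ k i) (multivariateGaussian (μ k) (S k)) P)
    (hindep : ∀ k, iIndepFun (δ k) P)
    -- safety tolerance, kind of constraint and risk levels of the modes
    (β : ℝ) (hβ : β ∈ Set.Ioo (0 : ℝ) 1)
    (kind : RiskKind) (ε : Fin K → ℝ) (hε : ∀ k, ε k ∈ Set.Ioo (0 : ℝ) 1)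
    (hchance : kind = RiskKind.chance → ∀ k, ε k ≤ 1 / 2)
    (x : EuclideanSpace ℝ (Fin n)) :
    1 - 2 * β ≤ P.real {ω |
      (∀ k, RobustConstraint (riskCoeff kind (ε k)) β (fun i => δ k i ω) (extendOne x)) →
        ∀ k, ExactConstraint (riskCoeff kind (ε k)) (μ k) (S k) (extendOne x)} := by

  by_cases hall : ∀ k, ExactConstraint (riskCoeff kind (ε k)) (μ k) (S k) (extendOne x)
  · simp only [hall, implies_true, Set.ofPred_true, probReal_univ]
    linarith [hβ.1]
  -- The exact constraints are deterministic, so the violated mode `k` is fixed in advance.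
  · obtain ⟨k, hk⟩ := not_forall.1 hall
    have hle := measureReal_robustConstraint_le (hN k) (hS k) (hlaw k) (hindep k) hβ
      (riskCoeff_nonneg (hε k).1 fun h => hchance h k) hk
    set G := {ω | (∀ k, RobustConstraint (riskCoeff kind (ε k)) β (fun i => δ k i ω)
      (extendOne x)) → ∀ k, ExactConstraint (riskCoeff kind (ε k)) (μ k) (S k) (extendOne x)}
    have hsub : Gᶜ ⊆ {ω | RobustConstraint (riskCoeff kind (ε k)) β (fun i => δ k i ω)
        (extendOne x)} := by
      intro ω hω
      exact (Classical.not_imp.1 hω).1 k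
    have huniv : (1 : ℝ) ≤ P.real G + P.real Gᶜ := by
      rw [← probReal_univ (μ := P), ← Set.union_compl_self G]
      exact measureReal_union_le _ _
    linarith [measureReal_mono hsub (μ := P)]
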